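/- Let the formulas of interpretability logic be built from $\bot$ and propositional variables $p_0,p_1,\dots$ by $\to$, $\Box$ and the binary modality $\rhd$; $\neg,\vee,\wedge,\top$ are defined as usual and $\Diamond A := \neg\Box\neg A$. Let $\mathbf{ILM}$ be the smallest set of formulas that is closed under modus ponens and necessitation and contains all (substitution instances of) propositional tautologies and all instances of $$\begin{array}{ll} \mathsf{L1} & \Box(A\to B)\to(\Box A\to\Box B)\\ \mathsf{L2} & \Box A\to\Box\Box A\\ \mathsf{L3} & \Box(\Box A\to A)\to\Box A\\ \mathsf{J1} & \Box(A\to B)\to (A\rhd B)\\ \mathsf{J2} & (A\rhd B)\wedge(B\rhd C)\to (A\rhd C)\\ \mathsf{J3} & (A\rhd C)\wedge(B\rhd C)\to ((A\vee B)\rhd C)\\ \mathsf{J4} & (A\rhd B)\to(\Diamond A\to\Diamond B)\\ \mathsf{J5} & \Diamond A\rhd A\\ \mathsf{M} & (A\rhd B)\to ((A\wedge\Box C)\rhd (B\wedge\Box C)). \end{array}$$ Let $\mathbf{GL}$ be the logic given in the same way by tautologies, $\mathsf{L1}$, $\mathsf{L2}$, $\mathsf{L3}$, modus ponens and necessitation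 in the language without $\rhd$. Write $\mathbf{X}\vdash A$ for $A\in\mathbf{X}$. Then, for all formulas $A$, $B$ of interpretability logic: 1. $\mathbf{ILM}\vdash\Box A$ if and only if $\mathbf{ILM}\vdash A$. 2. $\mathbf{ILM}\vdash\Box A\vee\Box B$ if and only if $\mathbf{ILM}\vdash\Box A$ or $\mathbf{ILM}\vdash\Box B$. 3. $\mathbf{ILM}\vdash A\rhd B$ if and only if $\mathbf{ILM}\vdash A\to B\vee\Diamond B$. 4. $\mathbf{ILM}\vdash A\rhd B$ if and only if $\mathbf{ILM}\vdash\Diamond A\to\Diamond B$. 5. If $A_1,\dots,A_n$ ($n\ge 0$) are formulas with $\mathbf{ILM}\nvdash\neg A_i$ for every $i$, then $\mathbf{ILM}\vdash\bigwedge_{i}\Diamond A_i\to (A\rhd B)$ if and only if $\mathbf{ILM}\vdash A\rhd B$ (the empty conjunction being $\top$). 6. $\mathbf{ILM}\vdash A\vee\Diamond A$ if and only if $\mathbf{ILM}\vdash\Box\bot\to A$. 7. $\mathbf{ILM}\vdash\top\rhd A$ if and only if $\mathbf{ILM}\vdash\Box\bot\to A$. Moreover, the statements without $\rhd$ hold for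 $\mathbf{GL}$: for all formulas $A$, $B$ without $\rhd$, statements 1, 2 and 6 hold with $\mathbf{GL}$ in place of $\mathbf{ILM}$, and $\mathbf{GL}\vdash A\to B\vee\Diamond B$ if and only if $\mathbf{GL}\vdash\Diamond A\to\Diamond B$. -/

import Mathlib

/-- Formulas of the language of interpretability logic, over the countable set
`p 0, p 1, ...` of propositional variables. The constructor `rhd A B` is `A ▷ B`. -/
inductive ILForm : Type
  | bot : ILForm
  | var : ℕ → ILForm
  | imp : ILForm → ILForm → ILForm
  | box : ILForm → ILForm
  | rhd : ILForm → ILForm → ILForm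

namespace ILForm

/-- `¬ A` -/
def neg (A : ILForm) : ILForm := imp A bot

/-- `⊤` -/
def top : ILForm := neg bot

/-- `A ∨ B` -/
def or (A B : ILForm) : ILForm := imp (neg A) B

/-- `A ∧ B` -/
def and (A B : ILForm) : ILForm := neg (imp A (neg B))

/-- `◇ A` is `¬ □ ¬ A`. -/
def dia (A : ILForm) : ILForm := neg (box (neg A))

/-- The conjunction of a finite list of formulas; the empty conjunction is `⊤`. -/
def conj : List ILForm → ILForm
  | [] => top
  | A :: L => and A (conj L)

/-- Propositional evaluation of a formula in which the propositional variables, the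
formulas `□ A` and the formulas `A ▷ B` count as atoms with truth values given by `v`. -/
def propEval (v : ILForm → Prop) : ILForm → Prop
  | bot => False
  | imp A B => propEval v A → propEval v B
  | var n => v (var n)
  | box A => v (box A)
  | rhd A B => v (rhd A B)

/-- Tautological formulas: the substitution instances of propositional tautologies. -/
def IsTautology (A : ILForm) : Prop := ∀ v : ILForm → Prop, propEval v A

end ILForm

/-- `ILX X A` says that `A` is a theorem of the logic `ILX`: the smallest set of formulas that
contains all tautological formulas, all instances of the axiom schemata `L1`-`L3` and `J1`-`J5`
and all formulas in `X` (the instances of the additional schemata), and that is closed under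
modus ponens and necessitation. -/
inductive ILX (X : Set ILForm) : ILForm → Prop
  | taut {A : ILForm} : A.IsTautology → ILX X A
  | L1 (A B : ILForm) : ILX X ((A.imp B).box.imp (A.box.imp B.box))
  | L2 (A : ILForm) : ILX X (A.box.imp A.box.box)
  | L3 (A : ILForm) : ILX X ((A.box.imp A).box.imp A.box)
  | J1 (A B : ILForm) : ILX X ((A.imp B).box.imp (A.rhd B))
  | J2 (A B C : ILForm) : ILX X (((A.rhd B).and (B.rhd C)).imp (A.rhd C))
  | J3 (A B C : ILForm) : ILX X (((A.rhd C).and (B.rhd C)).imp ((A.or B).rhd C))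
  | J4 (A B : ILForm) : ILX X ((A.rhd B).imp (A.dia.imp B.dia))
  | J5 (A : ILForm) : ILX X (A.dia.rhd A)
  | extra {A : ILForm} : A ∈ X → ILX X A
  | mp {A B : ILForm} : ILX X (A.imp B) → ILX X A → ILX X B
  | nec {A : ILForm} : ILX X A → ILX X A.box

/-- The instances `A ▷ B → (A ∧ □ C) ▷ (B ∧ □ C)` of Montagna's principle. -/
def montagna : Set ILForm :=
  {F | ∃ A B C : ILForm, F = (A.rhd B).imp ((A.and C.box).rhd (B.and C.box))}

/-- `ILM A` says that `A` is a theorem of `ILM`, that is, of `IL` with Montagna's principle. -/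
def ILM (A : ILForm) : Prop := ILX montagna A

/-- Formulas of the language of provability logic (no `▷`), over the same variables. -/
inductive GLForm : Type
  | bot : GLForm
  | var : ℕ → GLForm
  | imp : GLForm → GLForm → GLForm
  | box : GLForm → GLForm

namespace GLForm

/-- `¬ A` -/
def neg (A : GLForm) : GLForm := imp A bot

/-- `A ∨ B` -/
def or (A B : GLForm) : GLForm := imp (neg A) B

/-- `◇ A` is `¬ □ ¬ A`. -/
def dia (A : GLForm) : GLForm := neg (box (neg A))

/-- Propositional evaluation of a formula in which the propositional variables and the
formulas `□ A` count as atoms with truth values given by `v`. -/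
def propEval (v : GLForm → Prop) : GLForm → Prop
  | bot => False
  | imp A B => propEval v A → propEval v B
  | var n => v (var n)
  | box A => v (box A)

/-- Tautological formulas: the substitution instances of propositional tautologies. -/
def IsTautology (A : GLForm) : Prop := ∀ v : GLForm → Prop, propEval v A

end GLForm

/-- `GLThm A` says that `A` is a theorem of Gödel-Löb logic: the logic given by tautological
formulas, the schemata `L1`-`L3`, modus ponens and necessitation in the language without `▷`. -/
inductive GLThm : GLForm → Prop
  | taut {A : GLForm} : A.IsTautology → GLThm A
  | L1 (A B : GLForm) : GLThm ((A.imp B).box.imp (A.box.imp B.box))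
  | L2 (A : GLForm) : GLThm (A.box.imp A.box.box)
  | L3 (A : GLForm) : GLThm ((A.box.imp A).box.imp A.box)
  | mp {A B : GLForm} : GLThm (A.imp B) → GLThm A → GLThm B
  | nec {A : GLForm} : GLThm A → GLThm A.box

namespace ILX

variable {X : Set ILForm}

open ILForm

/-! The engine is a syntactic truth assignment. Fix `H` with `H → □H` provable, and let `□C` be true
when `H` proves `C`, and `A ▷ B` true when `H` proves `A → B ∨ ◇B`. Induction on derivations shows
that every theorem is true (`propEval_provableFrom`). With `H = ⊤` this turns provable boxes,
disjunctions of boxes and `▷`-formulas into provability statements; with `H = ¬B ∧ □¬B` it recovers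
`A → B ∨ ◇B` from `◇A → ◇B`. The converses are short derivations in the logic. -/

theorem mp₂ {A B C : ILForm} (h : ILX X (A.imp (B.imp C))) (hA : ILX X A) (hB : ILX X B) :
    ILX X C :=
  (h.mp hA).mp hB

theorem box_mono {A B : ILForm} (h : ILX X (A.imp B)) : ILX X (A.box.imp B.box) :=
  (L1 A B).mp h.nec

theorem box_mono₂ {A B C : ILForm} (h : ILX X (A.imp (B.imp C))) :
    ILX X (A.box.imp (B.box.imp C.box)) :=
  mp₂ (taut fun v => by simp only [propEval]; tauto) h.box_mono (L1 B C)

theorem box_mono₃ {A B C D : ILForm} (h : ILX X (A.imp (B.imp (C.imp D)))) :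
    ILX X (A.box.imp (B.box.imp (C.box.imp D.box))) :=
  mp₂ (taut fun v => by simp only [propEval]; tauto) h.box_mono₂ (L1 C D)

theorem imp_of {A B : ILForm} (h : ILX X B) : ILX X (A.imp B) :=
  mp (taut fun v => by simp only [propEval]; tauto) h

theorem trans {A B C : ILForm} (h₁ : ILX X (A.imp B)) (h₂ : ILX X (B.imp C)) :
    ILX X (A.imp C) :=
  mp₂ (taut fun v => by simp only [propEval]; tauto) h₁ h₂

theorem provable_top : ILX X top :=
  taut fun v => by simp [top, neg, propEval]

theorem top_imp {A : ILForm} : ILX X (top.imp A) ↔ ILX X A :=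
  ⟨fun h => h.mp provable_top, imp_of⟩

/-- `A ∧ □A` implies its own necessitation. -/
theorem and_box_imp_box (A : ILForm) : ILX X ((A.and A.box).imp (A.and A.box).box) :=
  mp₂ (taut fun v => by simp only [ILForm.and, neg, propEval]; tauto)
    (box_mono₂ (C := A.and A.box) (taut (A := A.imp (A.box.imp (A.and A.box)))
      fun v => by simp only [ILForm.and, neg, propEval]; tauto))
    (L2 A)

/-- The valuation of atoms in which `□C` means that `C` is provable from `H`, and `A ▷ B` means
that `A → B ∨ ◇B` is provable from `H`. -/
def provableFrom (X : Set ILForm) (H : ILForm) : ILForm → Prop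
  | box C => ILX X (H.imp C)
  | rhd A B => ILX X (H.imp (A.imp (B.or B.dia)))
  | _ => False

end ILX

/-! ### Soundness of the valuation and the rules for `ILM` -/

namespace ILM

open ILForm ILX

theorem propEval_provableFrom {H : ILForm} (hH : ILM (H.imp H.box)) {F : ILForm} (h : ILM F) :
    propEval (provableFrom montagna H) F := by
  induction h with
  | taut h => exact h _
  | mp _ _ ih₁ ih₂ => exact ih₁ ih₂
  -- Truth of the premise would not suffice here; its provability does.
  | nec h _ => exact h.imp_of
  | L1 A B =>
    intro h₁ h₂
    exact mp₂ (taut fun v => by simp only [propEval]; tauto) h₁ h₂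
  | L2 A =>
    intro h
    exact hH.trans h.box_mono
  | L3 A =>
    intro h
    -- Closure under Löb's rule relative to `H`, possible because `H` implies `□H`.
    have h₁ : ILX montagna (H.imp A.box) := (hH.trans h.box_mono).trans (L3 A)
    exact mp₂ (taut fun v => by simp only [propEval]; tauto) h h₁
  | J1 A B =>
    intro h
    exact mp (taut fun v => by simp only [ILForm.or, neg, propEval]; tauto) h
  | J2 A B C =>
    intro h
    obtain ⟨h₁, h₂⟩ : ILX montagna (H.imp (A.imp (B.or B.dia))) ∧
        ILX montagna (H.imp (B.imp (C.or C.dia))) := by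
      simpa [ILForm.and, neg, propEval, provableFrom] using h
    have h₃ : ILX montagna (H.imp (C.neg.imp (C.neg.box.imp B.neg))) :=
      mp (taut fun v => by simp only [ILForm.or, dia, neg, propEval]; tauto) h₂
    -- Under `H`, `◇B` implies `◇C`: box the previous line, using `□H` and `□□¬C`.
    have h₄ : ILX montagna (H.imp (C.neg.box.imp B.neg.box)) :=
      mp₂ (mp (taut fun v => by simp only [propEval]; tauto) hH) (L2 C.neg) h₃.box_mono₃
    exact mp₂ (mp (taut fun v => by simp only [ILForm.or, dia, neg, propEval]; tauto) h₁) h₂ h₄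
  | J3 A B C =>
    intro h
    obtain ⟨h₁, h₂⟩ : ILX montagna (H.imp (A.imp (C.or C.dia))) ∧
        ILX montagna (H.imp (B.imp (C.or C.dia))) := by
      simpa [ILForm.and, neg, propEval, provableFrom] using h
    exact mp₂ (taut fun v => by simp only [ILForm.or, dia, neg, propEval]; tauto) h₁ h₂
  | J4 A B =>
    intro h hA hB
    have h₁ : ILX montagna (H.imp (A.imp (B.or B.dia))) := h
    have h₂ : ILX montagna (H.imp B.neg) := hB
    exact hA (mp₂ (mp (taut fun v => by simp only [ILForm.or, dia, neg, propEval]; tauto) h₁) h₂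
      (hH.trans h₂.box_mono))
  | J5 A =>
    exact taut fun v => by simp only [ILForm.or, dia, neg, propEval]; tauto
  | extra h =>
    obtain ⟨A, B, C, rfl⟩ := h
    intro h
    have h₁ : ILX montagna (H.imp (A.imp (B.or B.dia))) := h
    -- Since `□C` gives `□□C`, a world witnessing `◇B` also satisfies `□C`.
    have h₂ : ILX montagna ((B.and C.box).neg.box.imp (C.box.box.imp B.neg.box)) :=
      box_mono₂ (taut fun v => by simp only [ILForm.and, neg, propEval]; tauto)
    exact mp₂ (mp (taut fun v => by
      simp only [ILForm.and, ILForm.or, dia, neg, propEval]; tauto) h₁) h₂ (L2 C)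

theorem propEval_provable {F : ILForm} (h : ILM F) : propEval (provableFrom montagna top) F :=
  propEval_provableFrom provable_top.nec.imp_of h

theorem box_iff (A : ILForm) : ILM A.box ↔ ILM A :=
  ⟨fun h => top_imp.1 (propEval_provable h), nec⟩

theorem box_or_box_iff (A B : ILForm) : ILM (A.box.or B.box) ↔ ILM A.box ∨ ILM B.box := by
  constructor
  · intro h
    by_cases hA : ILM A
    · exact Or.inl hA.nec
    · exact Or.inr (nec (top_imp.1 (propEval_provable h fun h' => hA (top_imp.1 h'))))
  · rintro (h | h)
    · exact mp (taut fun v => by simp only [ILForm.or, neg, propEval]; tauto) h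
    · exact mp (taut fun v => by simp only [ILForm.or, neg, propEval]; tauto) h

theorem rhd_of_imp {A B : ILForm} (h : ILM (A.imp (B.or B.dia))) : ILM (A.rhd B) := by
  have h₁ : ILM (A.rhd (B.or B.dia)) := (J1 _ _).mp h.nec
  have h₂ : ILM (B.rhd B) := (J1 _ _).mp (nec (taut fun _ => id))
  have h₃ : ILM ((B.or B.dia).rhd B) :=
    mp₂ (mp (taut fun v => by simp only [ILForm.and, neg, propEval]; tauto) (J3 B B.dia B))
      h₂ (J5 B)
  exact mp₂ (mp (taut fun v => by simp only [ILForm.and, neg, propEval]; tauto)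
    (J2 A (B.or B.dia) B)) h₁ h₃

theorem rhd_iff_imp (A B : ILForm) : ILM (A.rhd B) ↔ ILM (A.imp (B.or B.dia)) :=
  ⟨fun h => top_imp.1 (propEval_provable h), rhd_of_imp⟩

/-- For `H = ¬B ∧ □¬B` the valuation makes `◇B` false, hence `◇A` false, so `H` proves `¬A`;
contrapose. -/
theorem imp_of_dia_imp_dia {A B : ILForm} (h : ILM (A.dia.imp B.dia)) :
    ILM (A.imp (B.or B.dia)) := by
  have hB : ILX montagna ((B.neg.and B.neg.box).imp B.neg) :=
    taut fun v => by simp only [ILForm.and, neg, propEval]; tauto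
  have hA : ILX montagna ((B.neg.and B.neg.box).imp A.neg) := by
    by_contra hA
    exact propEval_provableFrom (and_box_imp_box B.neg) h hA hB
  exact mp (taut fun v => by simp only [ILForm.and, ILForm.or, dia, neg, propEval]; tauto) hA

theorem rhd_iff_dia_imp_dia (A B : ILForm) : ILM (A.rhd B) ↔ ILM (A.dia.imp B.dia) :=
  ⟨(J4 A B).mp, fun h => rhd_of_imp (imp_of_dia_imp_dia h)⟩

/-- Over `⊤`, `◇C` is true exactly when `C` is irrefutable, so such premises can be discharged. -/
theorem propEval_conj_dia {L : List ILForm} (hL : ∀ C ∈ L, ¬ ILM C.neg) :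
    propEval (provableFrom montagna top) (conj (L.map dia)) := by
  induction L with
  | nil => exact id
  | cons C L ih =>
    have hC : propEval (provableFrom montagna top) C.dia :=
      fun h => hL C List.mem_cons_self (top_imp.1 h)
    exact fun h => h hC (ih fun D hD => hL D (List.mem_cons_of_mem C hD))

theorem conj_dia_imp_rhd_iff (L : List ILForm) (A B : ILForm) (hL : ∀ C ∈ L, ¬ ILM C.neg) :
    ILM ((conj (L.map dia)).imp (A.rhd B)) ↔ ILM (A.rhd B) :=
  ⟨fun h => rhd_of_imp (top_imp.1 (propEval_provable h (propEval_conj_dia hL))), imp_of⟩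

theorem or_dia_iff (A : ILForm) : ILM (A.or A.dia) ↔ ILM (bot.box.imp A) := by
  constructor
  · intro h
    have h₁ : ILX montagna (bot.box.imp A.neg.box) :=
      box_mono (taut fun v => by simp only [propEval]; tauto)
    exact mp₂ (taut fun v => by simp only [ILForm.or, dia, neg, propEval]; tauto) h h₁
  · intro h
    -- `□¬A` yields `□¬□⊥`, hence `□⊥` by Löb, hence `A`.
    have h₁ : ILX montagna (A.neg.box.imp (bot.box.imp bot).box) :=
      box_mono (mp (taut fun v => by simp only [neg, propEval]; tauto) h)
    exact mp₂ (taut fun v => by simp only [ILForm.or, dia, neg, propEval]; tauto) h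
      (h₁.trans (L3 bot))

theorem top_rhd_iff (A : ILForm) : ILM (top.rhd A) ↔ ILM (bot.box.imp A) :=
  (rhd_iff_imp top A).trans (top_imp.trans (or_dia_iff A))

end ILM

/-! ### The same method for `GL` -/

namespace GLThm

open GLForm

theorem mp₂ {A B C : GLForm} (h : GLThm (A.imp (B.imp C))) (hA : GLThm A) (hB : GLThm B) :
    GLThm C :=
  (h.mp hA).mp hB

theorem box_mono {A B : GLForm} (h : GLThm (A.imp B)) : GLThm (A.box.imp B.box) :=
  (L1 A B).mp h.nec

theorem box_mono₂ {A B C : GLForm} (h : GLThm (A.imp (B.imp C))) :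
    GLThm (A.box.imp (B.box.imp C.box)) :=
  mp₂ (taut fun v => by simp only [propEval]; tauto) h.box_mono (L1 B C)

theorem imp_of {A B : GLForm} (h : GLThm B) : GLThm (A.imp B) :=
  mp (taut fun v => by simp only [propEval]; tauto) h

theorem trans {A B C : GLForm} (h₁ : GLThm (A.imp B)) (h₂ : GLThm (B.imp C)) :
    GLThm (A.imp C) :=
  mp₂ (taut fun v => by simp only [propEval]; tauto) h₁ h₂

/-- The valuation of atoms in which `□C` means that `C` is provable from `H`. -/
def provableFrom (H : GLForm) : GLForm → Prop
  | box C => GLThm (H.imp C)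
  | _ => False

theorem propEval_provableFrom {H : GLForm} (hH : GLThm (H.imp H.box)) {F : GLForm}
    (h : GLThm F) : propEval (provableFrom H) F := by
  induction h with
  | taut h => exact h _
  | mp _ _ ih₁ ih₂ => exact ih₁ ih₂
  | nec h _ => exact h.imp_of
  | L1 A B =>
    intro h₁ h₂
    exact mp₂ (taut fun v => by simp only [propEval]; tauto) h₁ h₂
  | L2 A =>
    intro h
    exact hH.trans h.box_mono
  | L3 A =>
    intro h
    have h₁ : GLThm (H.imp A.box) := (hH.trans h.box_mono).trans (L3 A)
    exact mp₂ (taut fun v => by simp only [propEval]; tauto) h h₁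

theorem provable_top : GLThm bot.neg :=
  taut fun _ => id

theorem top_imp {A : GLForm} : GLThm (bot.neg.imp A) ↔ GLThm A :=
  ⟨fun h => h.mp provable_top, imp_of⟩

theorem propEval_provable {F : GLForm} (h : GLThm F) : propEval (provableFrom bot.neg) F :=
  propEval_provableFrom provable_top.nec.imp_of h

theorem box_iff (A : GLForm) : GLThm A.box ↔ GLThm A :=
  ⟨fun h => top_imp.1 (propEval_provable h), nec⟩

theorem box_or_box_iff (A B : GLForm) :
    GLThm (A.box.or B.box) ↔ GLThm A.box ∨ GLThm B.box := by
  constructor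
  · intro h
    by_cases hA : GLThm A
    · exact Or.inl hA.nec
    · exact Or.inr (nec (top_imp.1 (propEval_provable h fun h' => hA (top_imp.1 h'))))
  · rintro (h | h)
    · exact mp (taut fun v => by simp only [GLForm.or, neg, propEval]; tauto) h
    · exact mp (taut fun v => by simp only [GLForm.or, neg, propEval]; tauto) h

/-- The negation of `B ∨ ◇B` implies its own necessitation. -/
theorem neg_or_dia_imp_box (B : GLForm) :
    GLThm ((B.or B.dia).neg.imp (B.or B.dia).neg.box) :=
  mp₂ (taut fun v => by simp only [GLForm.or, dia, neg, propEval]; tauto)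
    (box_mono₂ (C := (B.or B.dia).neg) (taut (A := B.neg.imp (B.neg.box.imp (B.or B.dia).neg))
      fun v => by simp only [GLForm.or, dia, neg, propEval]; tauto))
    (L2 B.neg)

theorem imp_or_dia_iff (A B : GLForm) :
    GLThm (A.imp (B.or B.dia)) ↔ GLThm (A.dia.imp B.dia) := by
  constructor
  · intro h
    -- Without `▷` and `J4`, this direction is derived by boxing the contrapositive.
    have h₁ : GLThm (B.neg.box.imp (B.neg.box.box.imp A.neg.box)) :=
      box_mono₂ (mp (taut fun v => by simp only [GLForm.or, dia, neg, propEval]; tauto) h)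
    exact mp₂ (taut fun v => by simp only [dia, neg, propEval]; tauto) h₁ (L2 B.neg)
  · intro h
    have hB : GLThm ((B.or B.dia).neg.imp B.neg) :=
      taut fun v => by simp only [GLForm.or, dia, neg, propEval]; tauto
    have hA : GLThm ((B.or B.dia).neg.imp A.neg) := by
      by_contra hA
      exact propEval_provableFrom (neg_or_dia_imp_box B) h hA hB
    exact mp (taut fun v => by simp only [GLForm.or, dia, neg, propEval]; tauto) hA

theorem or_dia_iff (A : GLForm) : GLThm (A.or A.dia) ↔ GLThm (bot.box.imp A) := by
  constructor
  · intro h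
    have h₁ : GLThm (bot.box.imp A.neg.box) :=
      box_mono (taut fun v => by simp only [propEval]; tauto)
    exact mp₂ (taut fun v => by simp only [GLForm.or, dia, neg, propEval]; tauto) h h₁
  · intro h
    have h₁ : GLThm (A.neg.box.imp (bot.box.imp bot).box) :=
      box_mono (mp (taut fun v => by simp only [neg, propEval]; tauto) h)
    exact mp₂ (taut fun v => by simp only [GLForm.or, dia, neg, propEval]; tauto) h
      (h₁.trans (L3 bot))

end GLThm

theorem lemma3p8 :
    -- the rules for `ILM`
    ((∀ A : ILForm, ILM A.box ↔ ILM A) ∧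
      (∀ A B : ILForm, ILM (A.box.or B.box) ↔ ILM A.box ∨ ILM B.box) ∧
      (∀ A B : ILForm, ILM (A.rhd B) ↔ ILM (A.imp (B.or B.dia))) ∧
      (∀ A B : ILForm, ILM (A.rhd B) ↔ ILM (A.dia.imp B.dia)) ∧
      (∀ (L : List ILForm) (A B : ILForm), (∀ C ∈ L, ¬ ILM C.neg) →
        (ILM ((ILForm.conj (L.map ILForm.dia)).imp (A.rhd B)) ↔ ILM (A.rhd B))) ∧
      (∀ A : ILForm, ILM (A.or A.dia) ↔ ILM (ILForm.bot.box.imp A)) ∧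
      (∀ A : ILForm, ILM (ILForm.top.rhd A) ↔ ILM (ILForm.bot.box.imp A))) ∧
    -- the rules without `▷` for `GL`
    ((∀ A : GLForm, GLThm A.box ↔ GLThm A) ∧
      (∀ A B : GLForm, GLThm (A.box.or B.box) ↔ GLThm A.box ∨ GLThm B.box) ∧
      (∀ A B : GLForm, GLThm (A.imp (B.or B.dia)) ↔ GLThm (A.dia.imp B.dia)) ∧
      (∀ A : GLForm, GLThm (A.or A.dia) ↔ GLThm (GLForm.bot.box.imp A))) :=
  ⟨⟨ILM.box_iff, ILM.box_or_box_iff, ILM.rhd_iff_imp, ILM.rhd_iff_dia_imp_dia,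
      ILM.conj_dia_imp_rhd_iff, ILM.or_dia_iff, ILM.top_rhd_iff⟩,
    ⟨GLThm.box_iff, GLThm.box_or_box_iff, GLThm.imp_or_dia_iff, GLThm.or_dia_iff⟩⟩
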